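/- Let $F$ be a field of characteristic different from $2$ and let $A$ be a Novikov algebra over $F$, i.e. a (not necessarily associative or unital) $F$-algebra satisfying $(x,y,z)=(y,x,z)$ and $(xy)z=(xz)y$ for all $x,y,z\in A$, where $(x,y,z)=(xy)z-x(yz)$. Put $A^{(0)_L}=A$ and let $A^{(n+1)_L}=[A^{(n)_L},A^{(n)_L}]$ be the subspace spanned by all commutators $xy-yx$ with $x,y\in A^{(n)_L}$. Suppose that $A$ is Lie-solvable, i.e. $A^{(n)_L}=0$ for some $n\ge 0$, and semiprime, i.e. $A$ has no nonzero two-sided ideal $I$ with $I^2=0$. Then $A$ is a subdirect product of integral domains: there are a (possibly empty) family $(B_i)_{i}$ of nonzero associative and commutative (not necessarily unital) $F$-algebras without nonzero zero divisors, and an injective homomorphism of $F$-algebras $\varphi\colon A\to\prod_i B_i$ whose composition with each projection $\prod_j B_j\to B_i$ is surjective. -/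

import Mathlib

universe u v

namespace Novikov

/-- The Novikov identities `(x, y, z) = (y, x, z)` and `(xy)z = (xz)y`, where
`(x, y, z) = (xy)z - x(yz)` is the associator. -/
structure IsNovikov (A : Type*) [NonUnitalNonAssocRing A] : Prop where
  left_symm : ∀ x y z : A, associator x y z = associator y x z
  right_comm : ∀ x y z : A, (x * y) * z = (x * z) * y

section Defs

variable (F : Type*) [Field F] (A : Type*) [NonUnitalNonAssocRing A] [Module F A]

/-- The Lie-solvable powers of `A`: the zeroth one is `A`, and the `(n+1)`-st one is the subspace
spanned by all commutators of elements of the `n`-th one. -/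
def lieSolvablePower : ℕ → Submodule F A
  | 0 => ⊤
  | n + 1 => Submodule.span F
      {z | ∃ x ∈ lieSolvablePower n, ∃ y ∈ lieSolvablePower n, z = x * y - y * x}

/-- `A` is Lie-solvable if some Lie-solvable power of `A` is zero. -/
def IsLieSolvable : Prop :=
  ∃ n : ℕ, lieSolvablePower F A n = ⊥

variable {F A} in
/-- A two-sided ideal of the algebra `A`: a subspace closed under left and right multiplication
by elements of `A`. -/
def IsIdeal (I : Submodule F A) : Prop :=
  ∀ a : A, ∀ x ∈ I, a * x ∈ I ∧ x * a ∈ I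

/-- `A` is semiprime if it has no nonzero ideal with zero multiplication. -/
def IsSemiprime : Prop :=
  ∀ I : Submodule F A, IsIdeal I → (∀ x ∈ I, ∀ y ∈ I, x * y = 0) → I = ⊥

end Defs

/-- An integral domain in the sense of not necessarily unital algebras: a nonzero associative and
commutative algebra without nonzero zero divisors. -/
structure IsIntegralDomain (B : Type*) [NonUnitalNonAssocRing B] : Prop where
  mul_assoc : ∀ x y z : B, (x * y) * z = x * (y * z)
  mul_comm : ∀ x y : B, x * y = y * x
  eq_zero_or_eq_zero : ∀ x y : B, x * y = 0 → x = 0 ∨ y = 0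
  exists_ne_zero : ∃ x : B, x ≠ 0

/-- An `F`-algebra homomorphism `φ` from `A` to a direct product of algebras represents `A` as a
subdirect product of the factors: `φ` is injective and maps onto each factor. -/
def IsSubdirect {F A ι : Type*} [Field F] [NonUnitalNonAssocRing A] [Module F A]
    {B : ι → Type*} [∀ i, NonUnitalNonAssocRing (B i)] [∀ i, Module F (B i)]
    (φ : A →ₙₐ[F] (∀ i, B i)) : Prop :=
  Function.Injective φ ∧ ∀ i, Function.Surjective fun a : A => φ a i

end Novikov

/-!
Let `D` be a commutative ideal of a semiprime Novikov algebra `A`. The elements of `D` that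
annihilate `D` form an ideal of square zero, so there are none but zero. For `a : A`, the map
`⁅a, ·⁆` is a derivation of `D` with `⁅a, x⁆y = x⁅a, y⁆`; evaluating `x⁅a, yz⁆` by both rules gives
`⁅a, x⁆yz = 2⁅a, x⁆yz`, so `⁅a, x⁆` annihilates `D` in two steps and `D` is central. Then
`2⁅x, y⁆z = ⁅xz, y⁆ + ⁅x, yz⁆` vanishes for `z ∈ D`, and hence `D = 0` as soon as `D ⊆ [A, A]`.
The Lie-solvable powers of `A` are ideals, and the last nonzero one is commutative, so it cannot lie
in `[A, A]`. Thus `[A, A] = 0`: the algebra `A` is commutative, hence associative and reduced, and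
its prime ideals intersect in zero.
-/

namespace Novikov

section Identities

variable {A : Type*} [NonUnitalNonAssocRing A]

theorem IsNovikov.leibniz_lie (hA : IsNovikov A) (a x y : A) :
    ⁅a, ⁅x, y⁆⁆ = ⁅⁅a, x⁆, y⁆ + ⁅x, ⁅a, y⁆⁆ :=
  letI : LeftPreLieRing A := { ‹NonUnitalNonAssocRing A› with assoc_symm' := hA.left_symm }
  _root_.leibniz_lie a x y

theorem IsNovikov.lie_mul_eq_mul_mul_sub (hA : IsNovikov A) (x y z : A) :
    ⁅x, y⁆ * z = x * (y * z) - y * (x * z) := by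
  have h := hA.left_symm x y z
  rw [associator_apply, associator_apply, sub_eq_sub_iff_sub_eq_sub] at h
  rw [Ring.lie_def, sub_mul, h]

theorem IsNovikov.two_nsmul_lie_mul (hA : IsNovikov A) (x y z : A) :
    2 • (⁅x, y⁆ * z) = ⁅x * z, y⁆ + ⁅x, y * z⁆ := by
  have h : ⁅x, y⁆ * z = x * z * y - y * z * x := by
    rw [Ring.lie_def, sub_mul, hA.right_comm x, hA.right_comm y]
  rw [two_nsmul]
  nth_rw 1 [h]
  rw [hA.lie_mul_eq_mul_mul_sub, Ring.lie_def, Ring.lie_def]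
  abel

theorem IsNovikov.mul_assoc_of_commute (hA : IsNovikov A) {x y z : A} (hxy : Commute x y)
    (hxyz : Commute x (y * z)) : x * y * z = x * (y * z) := by
  rw [hxy.eq, hA.right_comm, hxyz.eq]

theorem IsNovikov.lie_mul_right_comm (hA : IsNovikov A) (a : A) {x y : A} (hxy : Commute x y) :
    ⁅a, x⁆ * y = ⁅a, y⁆ * x := by
  rw [Ring.lie_def, Ring.lie_def, sub_mul, sub_mul, hA.right_comm a, hA.right_comm x, hxy.eq,
    hA.right_comm y]

theorem IsNovikov.lie_mul_of_commute (hA : IsNovikov A) {a x y : A} (hxy : Commute x y)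
    (hxya : Commute x (y * a)) : ⁅a, x * y⁆ = ⁅a, x⁆ * y + x * ⁅a, y⁆ := by
  rw [hA.lie_mul_eq_mul_mul_sub, Ring.lie_def, Ring.lie_def, mul_sub,
    hA.mul_assoc_of_commute hxy hxya]
  abel

/-- The commutative ring underlying a commutative Novikov algebra, whose multiplication is
automatically associative. -/
abbrev IsNovikov.nonUnitalCommRing (hA : IsNovikov A) (hcomm : ∀ x y : A, Commute x y) :
    NonUnitalCommRing A where
  mul_assoc _ _ _ := hA.mul_assoc_of_commute (hcomm _ _) (hcomm _ _)
  mul_comm x y := hcomm x y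

theorem IsNovikov.of_nonUnitalCommRing (A : Type*) [NonUnitalCommRing A] : IsNovikov A where
  left_symm x y z := by simp [associator_apply, mul_assoc, mul_left_comm]
  right_comm := mul_right_comm

end Identities

section CommutativeIdeals

variable {F : Type*} [Field F] {A : Type*} [NonUnitalNonAssocRing A] [Module F A]
  {D : Submodule F A}

theorem IsIdeal.lie_mem (hD : IsIdeal D) (a : A) {x : A} (hx : x ∈ D) : ⁅a, x⁆ ∈ D :=
  sub_mem (hD a x hx).1 (hD a x hx).2

theorem isIdeal_top : IsIdeal (⊤ : Submodule F A) :=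
  fun _ _ _ => ⟨Submodule.mem_top, Submodule.mem_top⟩

theorem IsNovikov.lie_mul_mul_eq_zero (hA : IsNovikov A) (hD : IsIdeal D)
    (hcomm : ∀ x ∈ D, ∀ y ∈ D, Commute x y) (a : A) {x y z : A} (hx : x ∈ D) (hy : y ∈ D)
    (hz : z ∈ D) : ⁅a, x⁆ * y * z = 0 := by
  have mul_mem {u v : A} (hu : u ∈ D) : u * v ∈ D := (hD v u hu).2
  have assoc {u v w : A} (hu : u ∈ D) (hv : v ∈ D) : u * v * w = u * (v * w) :=
    hA.mul_assoc_of_commute (hcomm u hu v hv) (hcomm u hu _ (mul_mem hv))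
  have swap {u v : A} (hu : u ∈ D) (hv : v ∈ D) : u * ⁅a, v⁆ = ⁅a, u⁆ * v := by
    rw [hcomm u hu _ (hD.lie_mem a hv), hA.lie_mul_right_comm a (hcomm v hv u hu)]
  have lie_yz : ⁅a, y * z⁆ = 2 • (⁅a, y⁆ * z) := by
    rw [hA.lie_mul_of_commute (hcomm y hy z hz) (hcomm y hy _ (mul_mem hz)), swap hy hz,
      two_nsmul]
  have double : ⁅a, x⁆ * y * z = 2 • (⁅a, x⁆ * y * z) :=
    calc ⁅a, x⁆ * y * z = x * ⁅a, y * z⁆ := by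
          rw [assoc (hD.lie_mem a hx) hy, swap hx (mul_mem hy)]
      _ = 2 • (x * ⁅a, y⁆ * z) := by
          rw [lie_yz, mul_smul_comm, assoc hx (hD.lie_mem a hy)]
      _ = 2 • (⁅a, x⁆ * y * z) := by rw [swap hx hy]
  rwa [two_nsmul, left_eq_add] at double

theorem IsNovikov.lie_mul_eq_zero_of_central (hF : (2 : F) ≠ 0) (hA : IsNovikov A)
    (hD : IsIdeal D) (hcentral : ∀ a, ∀ z ∈ D, Commute a z) (x y : A) {z : A} (hz : z ∈ D) :
    ⁅x, y⁆ * z = 0 := by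
  have h := hA.two_nsmul_lie_mul x y z
  rw [(hcentral y _ (hD x z hz).1).symm.lie_eq, (hcentral x _ (hD y z hz).1).lie_eq, add_zero,
    ← ofNat_smul_eq_nsmul F 2] at h
  exact (smul_eq_zero.1 h).resolve_left hF

section LeftAnnihilator

variable [IsScalarTower F A A]

/-- The left annihilator `{z | zD = 0}` of a subspace `D`. -/
def leftAnnihilator (D : Submodule F A) : Submodule F A where
  carrier := {z | ∀ y ∈ D, z * y = 0}
  zero_mem' _ _ := zero_mul _
  add_mem' ha hb y hy := by rw [add_mul, ha y hy, hb y hy, add_zero]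
  smul_mem' c z hz y hy := by rw [smul_mul_assoc, hz y hy, smul_zero]

theorem IsNovikov.isIdeal_inf_leftAnnihilator (hA : IsNovikov A) (hD : IsIdeal D)
    (hcomm : ∀ x ∈ D, ∀ y ∈ D, Commute x y) : IsIdeal (D ⊓ leftAnnihilator D) := by
  rintro a z ⟨hzD, hz⟩
  refine ⟨⟨(hD a z hzD).1, fun y hy => ?_⟩, ⟨(hD a z hzD).2, fun y hy => ?_⟩⟩
  · rw [hA.right_comm, hcomm _ (hD a y hy).1 z hzD, hz _ (hD a y hy).1]
  · rw [hA.right_comm, hz y hy, zero_mul]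

theorem IsSemiprime.inf_leftAnnihilator_eq_bot (hsemi : IsSemiprime F A) (hA : IsNovikov A)
    (hD : IsIdeal D) (hcomm : ∀ x ∈ D, ∀ y ∈ D, Commute x y) : D ⊓ leftAnnihilator D = ⊥ :=
  hsemi _ (hA.isIdeal_inf_leftAnnihilator hD hcomm) fun _ hx y hy => hx.2 y hy.1

theorem IsSemiprime.eq_zero_of_forall_mul_eq_zero (hsemi : IsSemiprime F A) (hA : IsNovikov A)
    (hD : IsIdeal D) (hcomm : ∀ x ∈ D, ∀ y ∈ D, Commute x y) {x : A} (hx : x ∈ D)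
    (hxD : ∀ y ∈ D, x * y = 0) : x = 0 := by
  rw [← Submodule.mem_bot F, ← hsemi.inf_leftAnnihilator_eq_bot hA hD hcomm]
  exact ⟨hx, hxD⟩

theorem IsSemiprime.central_of_commutative (hsemi : IsSemiprime F A) (hA : IsNovikov A)
    (hD : IsIdeal D) (hcomm : ∀ x ∈ D, ∀ y ∈ D, Commute x y) (a : A) {x : A} (hx : x ∈ D) :
    Commute a x := by
  have eq_zero {u : A} (hu : u ∈ D) (huD : ∀ y ∈ D, u * y = 0) : u = 0 :=
    hsemi.eq_zero_of_forall_mul_eq_zero hA hD hcomm hu huD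
  have hax : ⁅a, x⁆ ∈ D := hD.lie_mem a hx
  have lie_eq_zero : ⁅a, x⁆ = 0 := eq_zero hax fun y hy =>
    eq_zero (hD y _ hax).2 fun z hz => hA.lie_mul_mul_eq_zero hD hcomm a hx hy hz
  exact commute_iff_lie_eq.2 lie_eq_zero

end LeftAnnihilator

end CommutativeIdeals

section LieSolvablePowers

variable {F : Type*} [Field F] {A : Type*} [NonUnitalNonAssocRing A] [Module F A]

theorem lie_mem_lieSolvablePower_succ {n : ℕ} {x y : A} (hx : x ∈ lieSolvablePower F A n)
    (hy : y ∈ lieSolvablePower F A n) : ⁅x, y⁆ ∈ lieSolvablePower F A (n + 1) :=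
  Submodule.subset_span ⟨x, hx, y, hy, rfl⟩

variable [IsScalarTower F A A] [SMulCommClass F A A]

variable (F A) in
/-- The commutator `⁅x, y⁆` as a bilinear map. The subspace `[I, J]` spanned by the commutators of
two subspaces is `Submodule.map₂ (commutatorMap F A) I J`. -/
def commutatorMap : A →ₗ[F] A →ₗ[F] A :=
  LinearMap.mul F A - (LinearMap.mul F A).flip

theorem commutatorMap_apply (x y : A) : commutatorMap F A x y = ⁅x, y⁆ := rfl

variable (F A) in
theorem lieSolvablePower_succ (n : ℕ) :
    lieSolvablePower F A (n + 1) = Submodule.map₂ (commutatorMap F A) (lieSolvablePower F A n)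
      (lieSolvablePower F A n) := by
  rw [Submodule.map₂_eq_span_image2, lieSolvablePower]
  congr 1
  ext z
  simp only [Set.mem_ofPred_eq, Set.mem_image2, SetLike.mem_coe, commutatorMap_apply, Ring.lie_def,
    eq_comm]

variable (F A) in
theorem lieSolvablePower_antitone : Antitone (lieSolvablePower F A) := by
  refine antitone_nat_of_succ_le fun n => ?_
  induction n with
  | zero => exact le_top
  | succ n ih =>
    rw [lieSolvablePower_succ F A (n + 1)]
    exact (Submodule.map₂_le_map₂ ih ih).trans (lieSolvablePower_succ F A n).ge

theorem IsNovikov.isIdeal_map₂_commutatorMap (hF : (2 : F) ≠ 0) (hA : IsNovikov A)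
    {I J : Submodule F A} (hI : IsIdeal I) (hJ : IsIdeal J) :
    IsIdeal (Submodule.map₂ (commutatorMap F A) I J) := by
  set K := Submodule.map₂ (commutatorMap F A) I J
  have lie_mem {x y : A} (hx : x ∈ I) (hy : y ∈ J) : ⁅x, y⁆ ∈ K :=
    Submodule.apply_mem_map₂ (commutatorMap F A) hx hy
  have right_mul (a : A) : K ≤ K.comap (LinearMap.mulRight F a) := by
    refine Submodule.map₂_le.2 fun x hx y hy => ?_
    rw [Submodule.mem_comap, LinearMap.mulRight_apply, commutatorMap_apply,
      ← K.smul_mem_iff hF, ofNat_smul_eq_nsmul, hA.two_nsmul_lie_mul]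
    exact add_mem (lie_mem (hI a x hx).2 hy) (lie_mem hx (hJ a y hy).2)
  have lie_left (a : A) : K ≤ K.comap (commutatorMap F A a) := by
    refine Submodule.map₂_le.2 fun x hx y hy => ?_
    rw [Submodule.mem_comap, commutatorMap_apply, commutatorMap_apply, hA.leibniz_lie]
    exact add_mem (lie_mem (hI.lie_mem a hx) hy) (lie_mem hx (hJ.lie_mem a hy))
  refine fun a z hz => ⟨?_, right_mul a hz⟩
  rw [← sub_add_cancel (a * z) (z * a)]
  exact add_mem (lie_left a hz) (right_mul a hz)

theorem IsNovikov.isIdeal_lieSolvablePower (hF : (2 : F) ≠ 0) (hA : IsNovikov A) (n : ℕ) :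
    IsIdeal (lieSolvablePower F A n) := by
  induction n with
  | zero => exact isIdeal_top
  | succ n ih =>
    rw [lieSolvablePower_succ]
    exact hA.isIdeal_map₂_commutatorMap hF ih ih

theorem IsSemiprime.eq_bot_of_commutative_of_le (hF : (2 : F) ≠ 0) (hsemi : IsSemiprime F A)
    (hA : IsNovikov A) {D : Submodule F A} (hD : IsIdeal D)
    (hcomm : ∀ x ∈ D, ∀ y ∈ D, Commute x y) (hle : D ≤ lieSolvablePower F A 1) : D = ⊥ := by
  have hcentral : ∀ a, ∀ z ∈ D, Commute a z := fun a _ hz =>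
    hsemi.central_of_commutative hA hD hcomm a hz
  refine hsemi D hD fun u hu z hz => ?_
  have h : lieSolvablePower F A 1 ≤ LinearMap.ker (LinearMap.mulRight F z) := by
    rw [lieSolvablePower_succ]
    exact Submodule.map₂_le.2 fun x _ y _ => hA.lie_mul_eq_zero_of_central hF hD hcentral x y hz
  exact h (hle hu)

theorem IsSemiprime.lieSolvablePower_one_eq_bot (hF : (2 : F) ≠ 0) (hsemi : IsSemiprime F A)
    (hA : IsNovikov A) (hsolv : IsLieSolvable F A) : lieSolvablePower F A 1 = ⊥ := by
  obtain ⟨n, hn⟩ := hsolv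
  replace hn : lieSolvablePower F A (n + 1) = ⊥ :=
    eq_bot_mono (lieSolvablePower_antitone F A n.le_succ) hn
  induction n with
  | zero => exact hn
  | succ n ih =>
    refine ih (hsemi.eq_bot_of_commutative_of_le hF hA (hA.isIdeal_lieSolvablePower hF (n + 1))
      (fun x hx y hy => ?_) (lieSolvablePower_antitone F A (Nat.le_add_left 1 n)))
    have h : ⁅x, y⁆ ∈ lieSolvablePower F A (n + 2) := lie_mem_lieSolvablePower_succ hx hy
    rwa [hn, Submodule.mem_bot, ← commute_iff_lie_eq] at h

theorem IsSemiprime.commute_of_isLieSolvable (hF : (2 : F) ≠ 0) (hsemi : IsSemiprime F A)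
    (hA : IsNovikov A) (hsolv : IsLieSolvable F A) (x y : A) : Commute x y := by
  have h : ⁅x, y⁆ ∈ lieSolvablePower F A 1 :=
    lie_mem_lieSolvablePower_succ Submodule.mem_top Submodule.mem_top
  rwa [hsemi.lieSolvablePower_one_eq_bot hF hA hsolv, Submodule.mem_bot,
    ← commute_iff_lie_eq] at h

end LieSolvablePowers

section Quotients

variable {F : Type*} [Field F] {A : Type*} [NonUnitalNonAssocRing A] [Module F A]

/-- The quotient algebra `A ⧸ I` by a two-sided ideal. It is a type synonym of the quotient space,
because its multiplication depends on the proof that `I` is an ideal. -/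
def IsIdeal.Quotient {I : Submodule F A} (_ : IsIdeal I) : Type _ := A ⧸ I

namespace IsIdeal.Quotient

variable {I : Submodule F A} (hI : IsIdeal I)

instance : AddCommGroup hI.Quotient := inferInstanceAs (AddCommGroup (A ⧸ I))

instance : Module F hI.Quotient := inferInstanceAs (Module F (A ⧸ I))

instance : Mul hI.Quotient where
  mul := Quotient.map₂ (· * ·) fun a a' ha b b' hb => by
    refine I.quotientRel_def.2 ?_
    rw [← sub_add_sub_cancel, ← mul_sub, ← sub_mul]
    exact add_mem (hI a _ (I.quotientRel_def.1 hb)).1 (hI b' _ (I.quotientRel_def.1 ha)).2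

instance : NonUnitalNonAssocRing hI.Quotient where
  left_distrib := by
    rintro ⟨a⟩ ⟨b⟩ ⟨c⟩
    exact congrArg (Submodule.Quotient.mk (p := I)) (mul_add a b c)
  right_distrib := by
    rintro ⟨a⟩ ⟨b⟩ ⟨c⟩
    exact congrArg (Submodule.Quotient.mk (p := I)) (add_mul a b c)
  zero_mul := by
    rintro ⟨a⟩
    exact congrArg (Submodule.Quotient.mk (p := I)) (zero_mul a)
  mul_zero := by
    rintro ⟨a⟩
    exact congrArg (Submodule.Quotient.mk (p := I)) (mul_zero a)

instance [IsScalarTower F A A] : IsScalarTower F hI.Quotient hI.Quotient where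
  smul_assoc := by
    rintro c ⟨a⟩ ⟨b⟩
    exact congrArg (Submodule.Quotient.mk (p := I)) (smul_mul_assoc c a b)

instance [SMulCommClass F A A] : SMulCommClass F hI.Quotient hI.Quotient where
  smul_comm := by
    rintro c ⟨a⟩ ⟨b⟩
    exact congrArg (Submodule.Quotient.mk (p := I)) (mul_smul_comm c a b).symm

/-- The projection of `A` onto `A ⧸ I`. -/
def mk : A →ₙₐ[F] hI.Quotient where
  __ := I.mkQ
  map_zero' := map_zero I.mkQ
  map_mul' _ _ := rfl

theorem mk_surjective : Function.Surjective (mk hI) := I.mkQ_surjective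

theorem mk_eq_zero {a : A} : mk hI a = 0 ↔ a ∈ I := Submodule.Quotient.mk_eq_zero I

end IsIdeal.Quotient

/-- The homomorphism from `A` to the product of its quotients by a family of ideals. -/
def toPiQuotient {ι : Type*} {I : ι → Submodule F A} (hI : ∀ i, IsIdeal (I i)) :
    A →ₙₐ[F] ∀ i, (hI i).Quotient where
  toFun a i := IsIdeal.Quotient.mk (hI i) a
  map_smul' c a := funext fun i => map_smul (IsIdeal.Quotient.mk (hI i)) c a
  map_zero' := funext fun i => map_zero (IsIdeal.Quotient.mk (hI i))
  map_add' a b := funext fun i => map_add (IsIdeal.Quotient.mk (hI i)) a b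
  map_mul' a b := funext fun i => map_mul (IsIdeal.Quotient.mk (hI i)) a b

theorem isSubdirect_toPiQuotient {ι : Type*} {I : ι → Submodule F A} (hI : ∀ i, IsIdeal (I i))
    (hbot : ⨅ i, I i = ⊥) : IsSubdirect (toPiQuotient hI) := by
  refine ⟨(injective_iff_map_eq_zero _).2 fun a ha => ?_, fun i =>
    IsIdeal.Quotient.mk_surjective (hI i)⟩
  rw [← Submodule.mem_bot F, ← hbot, Submodule.mem_iInf]
  exact fun i => (IsIdeal.Quotient.mk_eq_zero (hI i)).1 (congrFun ha i)

/-- A completely prime ideal: a proper ideal that contains one of the factors of each product it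
contains. These are the ideals whose quotients have no zero divisors. -/
structure IsCompletelyPrime (P : Submodule F A) : Prop where
  isIdeal : IsIdeal P
  ne_top : P ≠ ⊤
  mem_or_mem : ∀ x y : A, x * y ∈ P → x ∈ P ∨ y ∈ P

end Quotients

section PrimeIdeals

theorem isReduced_unitization {F A : Type*} [CommSemiring F] [IsReduced F] [NonUnitalCommSemiring A]
    [Module F A] [IsScalarTower F A A] [SMulCommClass F A A]
    (hred : ∀ x : A, x * x = 0 → x = 0) : IsReduced (Unitization F A) := by
  refine (isReduced_iff_pow_one_lt 2 one_lt_two).2 fun z hz => ?_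
  rw [pow_two] at hz
  have hfst : z.fst = 0 :=
    eq_zero_of_pow_eq_zero (n := 2) (by simpa [pow_two] using congrArg (·.fst) hz)
  have hsnd : z.snd = 0 := hred _ (by simpa [hfst] using congrArg (·.snd) hz)
  exact Unitization.ext hfst hsnd

variable {F : Type*} [Field F] {A : Type*} [NonUnitalCommRing A] [Module F A]

theorem IsCompletelyPrime.isIntegralDomain_quotient {P : Submodule F A}
    (hP : IsCompletelyPrime P) : IsIntegralDomain hP.isIdeal.Quotient := by
  have hsurj := IsIdeal.Quotient.mk_surjective hP.isIdeal
  constructor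
  · rw [hsurj.forall₃]
    exact fun x y z => congrArg (IsIdeal.Quotient.mk hP.isIdeal) (mul_assoc x y z)
  · rw [hsurj.forall₂]
    exact fun x y => congrArg (IsIdeal.Quotient.mk hP.isIdeal) (mul_comm x y)
  · rw [hsurj.forall₂]
    simpa only [← map_mul, IsIdeal.Quotient.mk_eq_zero] using hP.mem_or_mem
  · obtain ⟨x, -, hx⟩ := SetLike.exists_of_lt hP.ne_top.lt_top
    exact ⟨_, (IsIdeal.Quotient.mk_eq_zero hP.isIdeal).not.2 hx⟩

variable [IsScalarTower F A A] [SMulCommClass F A A]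

theorem IsSemiprime.eq_zero_of_mul_self_eq_zero (hsemi : IsSemiprime F A) {x : A}
    (hx : x * x = 0) : x = 0 := by
  have range_eq_bot : LinearMap.range (LinearMap.mulLeft F x) = ⊥ := by
    refine hsemi _ ?_ ?_
    · rintro a _ ⟨b, rfl⟩
      exact ⟨⟨a * b, mul_left_comm x a b⟩, ⟨b * a, (mul_assoc x b a).symm⟩⟩
    · rintro _ ⟨a, rfl⟩ _ ⟨b, rfl⟩
      rw [LinearMap.mulLeft_apply, LinearMap.mulLeft_apply, mul_mul_mul_comm, hx, zero_mul]
  refine hsemi.eq_zero_of_forall_mul_eq_zero (IsNovikov.of_nonUnitalCommRing A) isIdeal_top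
    (fun x _ y _ => mul_comm x y) Submodule.mem_top fun y _ => ?_
  exact LinearMap.congr_fun (LinearMap.range_eq_bot.1 range_eq_bot) y

theorem isCompletelyPrime_comap_inr {P : Ideal (Unitization F A)} (hP : P.IsPrime) {x : A}
    (hx : Unitization.inr x ∉ P) :
    IsCompletelyPrime ((P.restrictScalars F).comap (Unitization.inrHom F F A)) where
  isIdeal a y hy := by
    simp only [Submodule.mem_comap, Submodule.restrictScalars_mem, Unitization.inrHom_apply,
      Unitization.inr_mul] at hy ⊢
    exact ⟨P.mul_mem_left _ hy, P.mul_mem_right _ hy⟩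
  ne_top h := hx (h.ge (Submodule.mem_top (x := x)))
  mem_or_mem y z h := hP.mem_or_mem (Unitization.inr_mul F y z ▸ h)

theorem IsSemiprime.iInf_isCompletelyPrime_eq_bot (hsemi : IsSemiprime F A) :
    ⨅ P : {P : Submodule F A // IsCompletelyPrime P}, P.1 = ⊥ := by
  have : IsReduced (Unitization F A) :=
    isReduced_unitization fun _ => hsemi.eq_zero_of_mul_self_eq_zero
  refine (Submodule.eq_bot_iff _).2 fun x hx => ?_
  have inr_nilpotent : IsNilpotent (Unitization.inr x : Unitization F A) := by
    refine nilpotent_iff_mem_prime.2 fun P hP => ?_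
    by_contra hxP
    exact hxP ((Submodule.mem_iInf _).1 hx ⟨_, isCompletelyPrime_comap_inr hP hxP⟩)
  exact Unitization.inr_injective (inr_nilpotent.eq_zero.trans (Unitization.inr_zero F).symm)

end PrimeIdeals

end Novikov

theorem corollary2 {F : Type u} [Field F] (hF : (2 : F) ≠ 0)
    {A : Type v} [NonUnitalNonAssocRing A] [Module F A] [IsScalarTower F A A]
    [SMulCommClass F A A] (hA : Novikov.IsNovikov A)
    (hsemi : Novikov.IsSemiprime F A) (hsolv : Novikov.IsLieSolvable F A) :
    ∃ (ι : Type v) (B : ι → Type v)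
      (_ : ∀ i, NonUnitalNonAssocRing (B i)) (_ : ∀ i, Module F (B i))
      (_ : ∀ i, IsScalarTower F (B i) (B i)) (_ : ∀ i, SMulCommClass F (B i) (B i))
      (φ : A →ₙₐ[F] (∀ i, B i)),
      (∀ i, Novikov.IsIntegralDomain (B i)) ∧ Novikov.IsSubdirect φ := by
  let _ : NonUnitalCommRing A :=
    hA.nonUnitalCommRing (hsemi.commute_of_isLieSolvable hF hA hsolv)
  have isIdeal (P : {P : Submodule F A // Novikov.IsCompletelyPrime P}) :
      Novikov.IsIdeal P.1 := P.2.isIdeal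
  exact ⟨_, fun P => (isIdeal P).Quotient, inferInstance, inferInstance, inferInstance,
    inferInstance, Novikov.toPiQuotient isIdeal, fun P => P.2.isIntegralDomain_quotient,
    Novikov.isSubdirect_toPiQuotient isIdeal hsemi.iInf_isCompletelyPrime_eq_bot⟩
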